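/- Fix $\varepsilon>0$, put $c(\varepsilon)=1/\sqrt{2\cosh(\varepsilon)-2}$, and for an irrational number $\alpha$ define the boundary function $$\mathscr{B}_\alpha(r)=\inf_{j\ge 1} c(\varepsilon)\sqrt{4\sin^2(\pi j\alpha)\,r^2+j^2}\qquad (r\ge 0),$$ where $j$ runs over the positive integers. Write $\mathscr{B}_\alpha(r)\asymp\sqrt r$ as $r\to\infty$ if there are constants $C\ge 1$ and $R>0$ (which may depend on $\alpha$ and $\varepsilon$) with $C^{-1}\sqrt r\le\mathscr{B}_\alpha(r)\le C\sqrt r$ for all $r\ge R$. **Theorem (Optimality of bounded type).** For every irrational $\alpha$ the following are equivalent: 1. $\mathscr{B}_\alpha(r)\asymp\sqrt r$ as $r\to\infty$; 2. $\alpha$ is Diophantine of exponent $2$, that is, there is $\kappa>0$ with $\left|\alpha-\frac pq\right|>\frac{\kappa}{|q|^2}$ for all integers $p$ and $q\neq0$; 3. $\alpha$ is of bounded type, that is, the partial quotients $a_1,a_2,\dots$ of the continued fraction $\alpha=\lfloor\alpha\rfloor+\cfrac{1}{a_1+\cfrac{1}{a_2+\cdots}}$ are bounded. Moreover, the constant in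 the upper bound is universal: there is $C>0$ depending only on $\varepsilon$ such that, for every irrational $\alpha$ satisfying these conditions, $\mathscr{B}_\alpha(r)\le C\sqrt r$ for all sufficiently large $r$. -/

import Mathlib

open Filter Asymptotics

noncomputable section

/-- The constant `c(ε) = 1 / √(2 cosh ε - 2)`. -/
def cuspConst (ε : ℝ) : ℝ := 1 / √(2 * Real.cosh ε - 2)

/-- The function `u_{α,j}(r) = c(ε) √(4 sin²(π j α) r² + j²)`. -/
def cuspU (ε α : ℝ) (j : ℕ) (r : ℝ) : ℝ :=
  cuspConst ε * √(4 * Real.sin (Real.pi * j * α) ^ 2 * r ^ 2 + (j : ℝ) ^ 2)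

/-- The boundary function `𝓑_α(r) = inf_{j ≥ 1} u_{α,j}(r)` of the Margulis region of the
screw translation with rotation angle `α` (in full turns). -/
def boundaryFun (ε α r : ℝ) : ℝ := ⨅ j : ℕ+, cuspU ε α j r

/-- `α` is Diophantine of exponent `ν`: for some `κ > 0`, `|α - p/q| > κ / |q|^ν` for every
rational number `p/q`. -/
def IsDiophantine (ν α : ℝ) : Prop :=
  ∃ κ : ℝ, 0 < κ ∧ ∀ p q : ℤ, q ≠ 0 → κ / |(q : ℝ)| ^ ν < |α - (p : ℝ) / (q : ℝ)|

/-- The partial quotients `a₁, a₂, …` in the continued fraction expansion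
`α = ⌊α⌋ + 1/(a₁ + 1/(a₂ + ⋯))` are bounded. -/
def HasBoundedPartialQuotients (α : ℝ) : Prop :=
  ∃ M : ℝ, ∀ (n : ℕ) (a : ℝ), (GenContFract.of α).partDens.get? n = some a → a ≤ M

end

/-! ### Continued fractions -/

namespace GenContFract

/-! Write `d_j` for the distance from `jα` to the nearest integer. Since `2 d_j ≤ |sin (π j α)| ≤ π
d_j`, the square of `cuspU` at `j` is comparable to `(d_j r)² + j²`. Dirichlet's theorem makes both
terms at most of order `r` for any `α`, whence the universal constant. If `j d_j ≥ κ`, AM-GM bounds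
the sum below by a multiple of `κ r`. Conversely, testing a lower bound `k √r` at `r` proportional
to `j²` forces `d_j` to be at least a constant over `j`.

For continued fractions, a convergent with denominator `q` and next partial quotient `a` has error
between `1/((a+2)q²)` and `1/(a q²)`; by Legendre, a reduced fraction with error below `1/(2q²)` is
a convergent. -/

/-- The continuants of the continued fraction of a real number are pairs of integers. -/
theorem exists_int_contsAux_eq (v : ℝ) (n : ℕ) :
    ∃ a b : ℤ, (GenContFract.of v).contsAux n = ⟨a, b⟩ := by
  induction n using Nat.twoStepInduction with
  | zero => exact ⟨1, 0, by simp⟩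
  | one => exact ⟨⌊v⌋, 1, by simp⟩
  | more n ih₁ ih₂ =>
    obtain ⟨a, b, h₁⟩ := ih₁
    obtain ⟨c, d, h₂⟩ := ih₂
    rcases h : (GenContFract.of v).s.get? n with _ | gp
    · exact ⟨c, d, by rw [contsAux_stable_step_of_terminated h, h₂]⟩
    · obtain ⟨ha, z, hz⟩ := of_partNum_eq_one_and_exists_int_partDen_eq h
      refine ⟨z * c + a, z * d + b, ?_⟩
      rw [contsAux_recurrence h h₁ h₂, ha, hz]
      simp

theorem exists_int_nums_eq (v : ℝ) (n : ℕ) : ∃ a : ℤ, (GenContFract.of v).nums n = a := by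
  obtain ⟨a, b, h⟩ := exists_int_contsAux_eq v (n + 1)
  exact ⟨a, by rw [num_eq_conts_a, nth_cont_eq_succ_nth_contAux, h]⟩

theorem exists_int_dens_eq (v : ℝ) (n : ℕ) : ∃ b : ℤ, (GenContFract.of v).dens n = b := by
  obtain ⟨a, b, h⟩ := exists_int_contsAux_eq v (n + 1)
  exact ⟨b, by rw [den_eq_conts_b, nth_cont_eq_succ_nth_contAux, h]⟩

theorem one_le_dens (v : ℝ) (n : ℕ) : 1 ≤ (GenContFract.of v).dens n := by
  induction n with
  | zero => simp
  | succ n ih => exact ih.trans of_den_mono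

/-- `contsAux` is shifted by one against `dens`, so this compares consecutive denominators. -/
theorem contsAux_b_le_dens (v : ℝ) (n : ℕ) :
    ((GenContFract.of v).contsAux n).b ≤ (GenContFract.of v).dens n := by
  cases n with
  | zero => simp
  | succ n => exact of_den_mono

theorem not_terminatedAt_of_irrational {v : ℝ} (hv : Irrational v) (n : ℕ) :
    ¬(GenContFract.of v).TerminatedAt n := fun h => by
  obtain ⟨q, hq⟩ := (terminates_iff_rat v).1 ⟨n, h⟩
  exact hv ⟨q, hq.symm⟩

/-- The denominator of a convergent of an irrational number is at most the reduced denominator,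
since numerator and denominator are coprime. -/
theorem dens_le_den_of_convs_eq {v : ℝ} (hv : Irrational v) {n : ℕ} {q : ℚ}
    (h : (GenContFract.of v).convs n = q) : (GenContFract.of v).dens n ≤ q.den := by
  obtain ⟨a, ha⟩ := exists_int_nums_eq v n
  obtain ⟨b, hb⟩ := exists_int_dens_eq v n
  obtain ⟨a', ha'⟩ := exists_int_nums_eq v (n + 1)
  obtain ⟨b', hb'⟩ := exists_int_dens_eq v (n + 1)
  have hdet := SimpContFract.determinant (s := SimpContFract.of v) (n := n)
    (not_terminatedAt_of_irrational hv n)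
  change (GenContFract.of v).nums n * (GenContFract.of v).dens (n + 1) -
    (GenContFract.of v).dens n * (GenContFract.of v).nums (n + 1) = _ at hdet
  rw [ha, hb, ha', hb'] at hdet
  have hdet' : a * b' - b * a' = (-1) ^ (n + 1) := by exact_mod_cast hdet
  -- The determinant identity for consecutive convergents is a Bézout relation.
  have hcop : IsCoprime b a := by
    refine ⟨-a' * (-1) ^ (n + 1), b' * (-1) ^ (n + 1), ?_⟩
    have : ((-1 : ℤ) ^ (n + 1)) * (-1) ^ (n + 1) = 1 := by
      rw [← mul_pow]; simp
    linear_combination (-1) ^ (n + 1) * hdet' + this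
  have hb1 := one_le_dens v n
  have hb0 : (b : ℝ) ≠ 0 := by rw [← hb]; positivity
  have hd0 : (q.den : ℝ) ≠ 0 := by exact_mod_cast q.den_nz
  rw [conv_eq_num_div_den, ha, hb, Rat.cast_def, div_eq_div_iff hb0 hd0] at h
  have h' : a * (q.den : ℤ) = q.num * b := by exact_mod_cast h
  have hdvd : b ∣ (q.den : ℤ) := hcop.dvd_of_dvd_mul_left (h' ▸ dvd_mul_left b q.num)
  have := Int.le_of_dvd (by exact_mod_cast q.pos) hdvd
  rw [hb]
  exact_mod_cast this

/-- The convergents of an irrational number are badly approximating when the next partial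
quotient is small. -/
theorem le_abs_sub_convs {v M : ℝ} (hv : Irrational v) {n : ℕ}
    (hM : ∀ a, (GenContFract.of v).partDens.get? n = some a → a ≤ M) :
    1 / ((M + 2) * (GenContFract.of v).dens n ^ 2) ≤ |v - (GenContFract.of v).convs n| := by
  have hnone : IntFractPair.stream v (n + 1) ≠ none := fun h =>
    not_terminatedAt_of_irrational hv n
      (of_terminatedAt_n_iff_succ_nth_intFractPair_stream_eq_none.2 h)
  obtain ⟨ifp', hifp'⟩ := Option.ne_none_iff_exists'.1 hnone
  obtain ⟨ifp, hifp, hfr, rfl⟩ := IntFractPair.succ_nth_stream_eq_some_iff.1 hifp'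
  have hfr0 : 0 < ifp.fr := (IntFractPair.nth_stream_fr_nonneg hifp).lt_of_ne' hfr
  have ha := hM _ (partDen_eq_s_b (get?_of_eq_some_of_succ_get?_intFractPair_stream hifp'))
  have hlt : ifp.fr⁻¹ < M + 1 := (Int.lt_floor_add_one ifp.fr⁻¹).trans_le
    (add_le_add_left ha 1)
  have hB := one_le_dens v n
  have hpB := contsAux_b_le_dens v n
  have hpB0 : 0 ≤ ((GenContFract.of v).contsAux n).b := zero_le_of_contsAux_b
  have hinv : 0 < ifp.fr⁻¹ := inv_pos.2 hfr0
  -- Exact error formula; `ifp.fr⁻¹` is the complete quotient, whose floor is the next partial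
  -- quotient.
  have heq := sub_convs_eq hifp
  simp only [hfr, if_false] at heq
  rw [heq]
  change _ ≤ |(-1) ^ n / ((GenContFract.of v).dens n *
    (ifp.fr⁻¹ * (GenContFract.of v).dens n + _))|
  set B := (GenContFract.of v).dens n
  set pB := ((GenContFract.of v).contsAux n).b
  have hpos : 0 < B * (ifp.fr⁻¹ * B + pB) := by positivity
  rw [abs_div, abs_pow, abs_neg, abs_one, one_pow, abs_of_pos hpos]
  apply one_div_le_one_div_of_le hpos
  calc B * (ifp.fr⁻¹ * B + pB) ≤ B * ((M + 1) * B + B) := by gcongr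
    _ = (M + 2) * B ^ 2 := by ring

end GenContFract

/-! ### Diophantine numbers and bounded partial quotients -/

/-- A number of Diophantine exponent `2` has bounded partial quotients. -/
theorem IsDiophantine.hasBoundedPartialQuotients {α : ℝ} (h : IsDiophantine 2 α) :
    HasBoundedPartialQuotients α := by
  obtain ⟨κ, hκ, h⟩ := h
  refine ⟨1 / κ, fun n a ha => ?_⟩
  obtain ⟨p, hp⟩ := GenContFract.exists_int_nums_eq α n
  obtain ⟨q, hq⟩ := GenContFract.exists_int_dens_eq α n
  have hB := GenContFract.one_le_dens α n
  have ha1 := GenContFract.of_one_le_get?_partDen ha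
  have hle := GenContFract.abs_sub_convergents_le' ha
  rw [GenContFract.conv_eq_num_div_den, hp, hq] at hle
  rw [hq] at hB
  have hq0 : q ≠ 0 := by rintro rfl; norm_num at hB
  have hlt := (h p q hq0).trans_le hle
  rw [Real.rpow_two, sq_abs, div_lt_div_iff₀ (by positivity) (by positivity)] at hlt
  rw [le_div_iff₀ hκ]
  have hq2 : (0 : ℝ) < (q : ℝ) ^ 2 := by positivity
  refine le_of_lt (lt_of_mul_lt_mul_right ?_ hq2.le)
  linarith

/-- An irrational number with bounded partial quotients is of Diophantine exponent `2`. -/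
theorem HasBoundedPartialQuotients.isDiophantine {α : ℝ} (hα : Irrational α)
    (h : HasBoundedPartialQuotients α) : IsDiophantine 2 α := by
  obtain ⟨M, hM⟩ := h
  -- Irrationality supplies a first partial quotient, and it is at least `1`.
  have hM1 : 1 ≤ M := by
    obtain ⟨gp, hgp⟩ := Option.ne_none_iff_exists'.1
      (GenContFract.not_terminatedAt_of_irrational hα 0)
    have h0 := GenContFract.partDen_eq_s_b hgp
    exact (GenContFract.of_one_le_get?_partDen h0).trans (hM 0 _ h0)
  have key : ∀ x : ℚ, 1 / ((M + 2) * (x.den : ℝ) ^ 2) ≤ |α - x| := by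
    intro x
    have hx : (0 : ℝ) < x.den := by exact_mod_cast x.pos
    by_cases hlt : |α - x| < 1 / (2 * (x.den : ℝ) ^ 2)
    · obtain ⟨n, hn⟩ := Real.exists_convs_eq_rat hlt
      rw [← hn]
      have hB := GenContFract.one_le_dens α n
      refine le_trans ?_ (GenContFract.le_abs_sub_convs hα (hM n))
      apply one_div_le_one_div_of_le (by positivity)
      have := GenContFract.dens_le_den_of_convs_eq hα hn
      gcongr
    · refine le_trans ?_ (not_lt.1 hlt)
      apply one_div_le_one_div_of_le (by positivity)
      gcongr
      linarith
  -- The extra factor `2` makes the inequality strict.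
  refine ⟨1 / (2 * (M + 2)), by positivity, fun p q hq => ?_⟩
  have hk := key ((p : ℚ) / q)
  have hden : (((p : ℚ) / q).den : ℝ) ≤ |(q : ℝ)| := by
    have hdvd : ((((p : ℚ) / q).den : ℤ)) ∣ q := by
      rw [Rat.intCast_div_eq_divInt]; exact Rat.den_dvd p q
    have := Int.le_of_dvd (abs_pos.2 hq) ((dvd_abs _ _).2 hdvd)
    exact_mod_cast this
  have hx : (0 : ℝ) < ((p : ℚ) / q).den := by exact_mod_cast Rat.pos _
  push_cast at hk
  refine lt_of_lt_of_le ?_ hk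
  rw [Real.rpow_two, div_div]
  apply one_div_lt_one_div_of_lt (by positivity)
  have h2 : (((p : ℚ) / q).den : ℝ) ^ 2 ≤ |(q : ℝ)| ^ 2 := by gcongr
  have h3 : (M + 2) * (((p : ℚ) / q).den : ℝ) ^ 2 ≤ (M + 2) * |(q : ℝ)| ^ 2 := by gcongr
  have h4 : 0 < (M + 2) * (((p : ℚ) / q).den : ℝ) ^ 2 := by positivity
  linarith

/-- Exponent `2` in terms of the distance of `j α` to the nearest integer. -/
theorem isDiophantine_two_iff_round {α : ℝ} :
    IsDiophantine 2 α ↔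
      ∃ κ : ℝ, 0 < κ ∧ ∀ j : ℕ, 0 < j → κ / j ≤ |j * α - round (j * α)| := by
  constructor
  · rintro ⟨κ, hκ, h⟩
    refine ⟨κ, hκ, fun j hj => ?_⟩
    have hj' : (0 : ℝ) < j := by exact_mod_cast hj
    have := h (round (j * α)) j (by exact_mod_cast hj.ne')
    rw [Int.cast_natCast, Real.rpow_two, sq_abs] at this
    calc κ / j = κ / j ^ 2 * j := by field_simp
      _ ≤ |α - round (j * α) / j| * j := by gcongr
      _ = |j * α - round (j * α)| := by
        rw [← abs_of_pos hj', ← abs_mul, abs_of_pos hj']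
        congr 1
        field_simp
  · rintro ⟨κ, hκ, h⟩
    refine ⟨κ / 2, by positivity, fun p q hq => ?_⟩
    have hq' : (0 : ℝ) < |(q : ℝ)| := abs_pos.2 (by exact_mod_cast hq)
    have hqa : ((q.natAbs : ℕ) : ℝ) = |(q : ℝ)| := by simp
    have h1 := h q.natAbs (Int.natAbs_pos.2 hq)
    have h2 : |(q : ℝ)| * |α - p / q| = |(q : ℝ) * α - p| := by
      rw [← abs_mul]
      congr 1
      have : (q : ℝ) ≠ 0 := by exact_mod_cast hq
      field_simp
    have h3 : |(q.natAbs : ℝ) * α - round ((q.natAbs : ℝ) * α)| ≤ |(q : ℝ) * α - p| := by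
      rcases abs_choice (q : ℝ) with hs | hs <;> rw [hqa, hs]
      · exact round_le _ _
      · refine (round_le _ (-p)).trans (le_of_eq ?_)
        rw [← abs_neg]
        congr 1
        push_cast
        ring
    rw [hqa] at h1 h3
    have h4 : κ / |(q : ℝ)| ≤ |(q : ℝ)| * |α - p / q| := h2 ▸ h1.trans h3
    rw [Real.rpow_two, div_lt_iff₀ (by positivity)]
    rw [div_le_iff₀ hq'] at h4
    linarith

/-! ### The boundary function -/

theorem cuspConst_pos {ε : ℝ} (hε : 0 < ε) : 0 < cuspConst ε := by
  have := Real.one_lt_cosh.2 hε.ne'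
  have : 0 < 2 * Real.cosh ε - 2 := by linarith
  rw [cuspConst]
  positivity

theorem cuspU_nonneg (ε α : ℝ) (j : ℕ) (r : ℝ) : 0 ≤ cuspU ε α j r := by
  rw [cuspU, cuspConst]
  positivity

theorem boundaryFun_nonneg (ε α r : ℝ) : 0 ≤ boundaryFun ε α r :=
  Real.iInf_nonneg fun j => cuspU_nonneg ε α j r

theorem boundaryFun_le_cuspU (ε α r : ℝ) {j : ℕ} (hj : 0 < j) :
    boundaryFun ε α r ≤ cuspU ε α j r :=
  ciInf_le (f := fun j : ℕ+ => cuspU ε α j r)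
    ⟨0, by rintro _ ⟨j, rfl⟩; exact cuspU_nonneg ε α j r⟩ ⟨j, hj⟩

theorem abs_sin_pi_mul_eq_abs_sin_sub_round (x : ℝ) :
    |Real.sin (Real.pi * x)| = |Real.sin (Real.pi * (x - round x))| := by
  have : Real.pi * (x - round x) = Real.pi * x - round x * Real.pi := by ring
  rw [this, Real.sin_sub_int_mul_pi, abs_mul]
  simp

theorem abs_sin_pi_mul_le (x : ℝ) : |Real.sin (Real.pi * x)| ≤ Real.pi * |x - round x| := by
  rw [abs_sin_pi_mul_eq_abs_sin_sub_round]
  refine Real.abs_sin_le_abs.trans_eq ?_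
  rw [abs_mul, abs_of_pos Real.pi_pos]

/-- Jordan's inequality, applicable because `|x - round x| ≤ 1/2`. -/
theorem two_mul_le_abs_sin_pi_mul (x : ℝ) :
    2 * |x - round x| ≤ |Real.sin (Real.pi * x)| := by
  rw [abs_sin_pi_mul_eq_abs_sin_sub_round]
  have hx := abs_sub_round x
  have hπ := Real.pi_pos
  have habs : |Real.pi * (x - round x)| = Real.pi * |x - round x| := by
    rw [abs_mul, abs_of_pos hπ]
  have h := Real.mul_abs_le_abs_sin (x := Real.pi * (x - round x)) (by rw [habs]; nlinarith)
  rw [habs] at h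
  refine le_trans (le_of_eq ?_) h
  field_simp

/-- By Dirichlet's theorem, the boundary function grows at most like `√r`, with a constant that
does not depend on `α`. -/
theorem boundaryFun_le_mul_sqrt {ε : ℝ} (hε : 0 < ε) (α : ℝ) {r : ℝ} (hr : 1 ≤ r) :
    boundaryFun ε α r ≤ cuspConst ε * √(4 * Real.pi ^ 2 + 1) * √r := by
  have hc := cuspConst_pos hε
  have hs : 1 ≤ √r := Real.one_le_sqrt.2 hr
  -- The cutoff `⌊√r⌋` balances the two terms: `j ≤ √r` and `d_j ≤ 1/√r`.
  obtain ⟨j, hj, hjn, h⟩ := Real.exists_nat_abs_mul_sub_round_le α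
    (Nat.floor_pos.2 hs)
  have hjs : (j : ℝ) ≤ √r := (Nat.cast_le.2 hjn).trans (Nat.floor_le (by positivity))
  have hd : |(j : ℝ) * α - round ((j : ℝ) * α)| ≤ 1 / √r :=
    h.trans (one_div_le_one_div_of_le (by positivity) (Nat.lt_floor_add_one _).le)
  refine (boundaryFun_le_cuspU ε α r hj).trans ?_
  rw [cuspU, mul_assoc Real.pi, mul_assoc (cuspConst ε), ← Real.sqrt_mul (by positivity)]
  refine mul_le_mul_of_nonneg_left (Real.sqrt_le_sqrt ?_) hc.le
  have hsq : √r ^ 2 = r := Real.sq_sqrt (by linarith)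
  have h1 : |Real.sin (Real.pi * (j * α))| ≤ Real.pi * (1 / √r) :=
    (abs_sin_pi_mul_le _).trans (by gcongr)
  have h2 : Real.sin (Real.pi * (j * α)) ^ 2 ≤ (Real.pi * (1 / √r)) ^ 2 := by
    rw [← sq_abs]; gcongr
  have h3 : (Real.pi * (1 / √r)) ^ 2 * r ^ 2 = Real.pi ^ 2 * r := by
    rw [mul_pow, div_pow, hsq]; field_simp
  have h4 : (j : ℝ) ^ 2 ≤ r := by rw [← hsq]; gcongr
  calc 4 * Real.sin (Real.pi * (j * α)) ^ 2 * r ^ 2 + (j : ℝ) ^ 2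
      ≤ 4 * (Real.pi * (1 / √r)) ^ 2 * r ^ 2 + r := by gcongr
    _ = (4 * Real.pi ^ 2 + 1) * r := by linear_combination 4 * h3

/-- For `α` of Diophantine exponent `2`, the boundary function grows at least like `√r`. -/
theorem exists_mul_sqrt_le_boundaryFun {ε : ℝ} (hε : 0 < ε) {α : ℝ} (h : IsDiophantine 2 α) :
    ∃ k : ℝ, 0 < k ∧ ∀ r : ℝ, 0 ≤ r → k * √r ≤ boundaryFun ε α r := by
  have hc := cuspConst_pos hε
  obtain ⟨κ, hκ, h⟩ := isDiophantine_two_iff_round.1 h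
  refine ⟨cuspConst ε * √(8 * κ), by positivity, fun r hr => le_ciInf fun j => ?_⟩
  have hj : (0 : ℝ) < (j : ℕ) := by exact_mod_cast j.pos
  rw [cuspU, mul_assoc Real.pi, mul_assoc (cuspConst ε), ← Real.sqrt_mul (by positivity)]
  refine mul_le_mul_of_nonneg_left (Real.sqrt_le_sqrt ?_) hc.le
  have h1 : 2 * (κ / (j : ℕ)) ≤ |Real.sin (Real.pi * ((j : ℕ) * α))| :=
    (mul_le_mul_of_nonneg_left (h j j.pos) zero_le_two).trans (two_mul_le_abs_sin_pi_mul _)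
  have h2 : (2 * (κ / (j : ℕ))) ^ 2 ≤ Real.sin (Real.pi * ((j : ℕ) * α)) ^ 2 := by
    rw [← sq_abs (Real.sin _)]; gcongr
  have h3 : κ / (j : ℕ) * (j : ℕ) = κ := by field_simp
  -- AM-GM for `4κr/j` and `j`, whose product is `4κr`.
  calc 8 * κ * r = 8 * (κ / (j : ℕ) * (j : ℕ)) * r := by rw [h3]
    _ ≤ 4 * (2 * (κ / (j : ℕ))) ^ 2 * r ^ 2 + ((j : ℕ) : ℝ) ^ 2 := by
      nlinarith [sq_nonneg (4 * (κ / (j : ℕ)) * r - (j : ℕ))]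
    _ ≤ _ := by gcongr

/-- If the boundary function eventually dominates a multiple of `√r`, then `α` is of Diophantine
exponent `2`. -/
theorem isDiophantine_of_mul_sqrt_le_boundaryFun {ε : ℝ} (hε : 0 < ε) {α k : ℝ} (hk : 0 < k)
    (h : ∀ᶠ r : ℝ in atTop, k * √r ≤ boundaryFun ε α r) : IsDiophantine 2 α := by
  have hc := cuspConst_pos hε
  set c := cuspConst ε with hcdef
  obtain ⟨R, hR⟩ := eventually_atTop.1 h
  -- At `r = l j²` the squared lower bound is at least `2c²j²`: one `c²j²` cancels the `j²` term of
  -- `cuspU`, the other bounds the sine term below. The maximum with `R` ensures `r ≥ R`.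
  set l := max (2 * c ^ 2 / k ^ 2) R with hl
  have hl0 : 0 < l := (by positivity : 0 < 2 * c ^ 2 / k ^ 2).trans_le (le_max_left _ _)
  refine isDiophantine_two_iff_round.2 ⟨1 / (2 * Real.pi * l), by positivity, fun j hj => ?_⟩
  have hj' : (1 : ℝ) ≤ j := by exact_mod_cast hj
  have hRj : R ≤ l * j ^ 2 := by
    have h1 : R ≤ l := le_max_right _ _
    exact h1.trans (le_mul_of_one_le_right hl0.le (one_le_pow₀ hj'))
  have hu := (hR _ hRj).trans (boundaryFun_le_cuspU ε α _ hj)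
  have hlk : 2 * c ^ 2 ≤ k ^ 2 * l := by
    rw [mul_comm (k ^ 2), ← div_le_iff₀ (by positivity)]; exact le_max_left _ _
  set d := |(j : ℝ) * α - round ((j : ℝ) * α)| with hd
  have hs : Real.sin (Real.pi * j * α) ^ 2 ≤ (Real.pi * d) ^ 2 := by
    rw [← sq_abs, mul_assoc]
    exact pow_le_pow_left₀ (abs_nonneg _) (abs_sin_pi_mul_le _) 2
  have hu2 : (k * √(l * j ^ 2)) ^ 2 ≤ cuspU ε α j (l * j ^ 2) ^ 2 := by gcongr
  rw [cuspU, mul_pow, mul_pow, Real.sq_sqrt (by positivity), Real.sq_sqrt (by positivity),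
    ← hcdef] at hu2
  have h1 : c ^ 2 * j ^ 2 ≤ c ^ 2 * (4 * (Real.pi * d) ^ 2 * (l * j ^ 2) ^ 2) := by
    have e1 : c ^ 2 * (4 * Real.sin (Real.pi * j * α) ^ 2 * (l * j ^ 2) ^ 2) ≤
        c ^ 2 * (4 * (Real.pi * d) ^ 2 * (l * j ^ 2) ^ 2) := by gcongr
    have e2 : 2 * c ^ 2 * (j : ℝ) ^ 2 ≤ k ^ 2 * l * j ^ 2 := by gcongr
    linarith
  have h2 : (j : ℝ) ^ 2 ≤ (2 * (Real.pi * d) * (l * j ^ 2)) ^ 2 := by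
    have := le_of_mul_le_mul_left h1 (by positivity)
    linarith
  have h3 : (j : ℝ) ≤ 2 * (Real.pi * d) * (l * j ^ 2) :=
    (pow_le_pow_iff_left₀ (by positivity) (by positivity) two_ne_zero).1 h2
  have h4 : (j : ℝ) * 1 ≤ j * (d * (2 * Real.pi * l * j)) := by linarith
  rw [div_div, div_le_iff₀ (by positivity)]
  exact le_of_mul_le_mul_left h4 (by positivity)

/-- The boundary function is of order `√r` exactly for `α` of Diophantine exponent `2`. -/
theorem boundaryFun_isTheta_sqrt_iff {ε : ℝ} (hε : 0 < ε) (α : ℝ) :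
    ((fun r : ℝ => boundaryFun ε α r) =Θ[atTop] fun r : ℝ => √r) ↔ IsDiophantine 2 α := by
  constructor
  · rintro ⟨-, h⟩
    obtain ⟨k, hk, h⟩ := h.exists_pos
    refine isDiophantine_of_mul_sqrt_le_boundaryFun hε (inv_pos.2 hk) (h.bound.mono fun r hr => ?_)
    rw [Real.norm_of_nonneg (Real.sqrt_nonneg r),
      Real.norm_of_nonneg (boundaryFun_nonneg ε α r)] at hr
    rwa [inv_mul_le_iff₀ hk]
  · intro h
    obtain ⟨k, hk, h⟩ := exists_mul_sqrt_le_boundaryFun hε h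
    constructor
    · refine IsBigO.of_bound (cuspConst ε * √(4 * Real.pi ^ 2 + 1)) ?_
      filter_upwards [eventually_ge_atTop 1] with r hr
      rw [Real.norm_of_nonneg (Real.sqrt_nonneg r),
        Real.norm_of_nonneg (boundaryFun_nonneg ε α r)]
      exact boundaryFun_le_mul_sqrt hε α hr
    · refine IsBigO.of_bound k⁻¹ ?_
      filter_upwards [eventually_ge_atTop 0] with r hr
      rw [Real.norm_of_nonneg (Real.sqrt_nonneg r),
        Real.norm_of_nonneg (boundaryFun_nonneg ε α r), le_inv_mul_iff₀ hk]
      exact h r hr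

theorem mainTheorem9 (ε : ℝ) (hε : 0 < ε) :
    (∀ α : ℝ, Irrational α →
      (((fun r : ℝ => boundaryFun ε α r) =Θ[atTop] fun r : ℝ => √r) ↔ IsDiophantine 2 α) ∧
      (((fun r : ℝ => boundaryFun ε α r) =Θ[atTop] fun r : ℝ => √r) ↔
        HasBoundedPartialQuotients α)) ∧
    ∃ C : ℝ, 0 < C ∧ ∀ α : ℝ, Irrational α → IsDiophantine 2 α →
      ∀ᶠ r : ℝ in atTop, boundaryFun ε α r ≤ C * √r := by
  have hc := cuspConst_pos hε
  refine ⟨fun α hα => ⟨boundaryFun_isTheta_sqrt_iff hε α, ?_⟩,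
    cuspConst ε * √(4 * Real.pi ^ 2 + 1), by positivity, fun α _ _ => ?_⟩
  · rw [boundaryFun_isTheta_sqrt_iff hε α]
    exact ⟨IsDiophantine.hasBoundedPartialQuotients,
      HasBoundedPartialQuotients.isDiophantine hα⟩
  · filter_upwards [eventually_ge_atTop 1] with r hr
    exact boundaryFun_le_mul_sqrt hε α hr
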